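/- Let $R_{12}$ be the double Riesz transform on $\mathbb{R}^2$ with kernel $K(x,y)=\frac{xy}{2\pi(x^2+y^2)^2}$, that is, for a Schwartz function $f:\mathbb{R}^2\to\mathbb{C}$ and $z\in\mathbb{R}^2$, $$R_{12}f(z)=\lim_{\varepsilon\to 0^+}\int_{|z-w|>\varepsilon}K(z-w)\,f(w)\,dw .$$ Then for every real number $p>2$ there is no finite constant $C_p$ such that $$\bigl\|\,\|R_{12}f(x,y)\|_{L^p_x(\mathbb{R})}\bigr\|_{L^\infty_y(\mathbb{R})}\le C_p\,\bigl\|\,\|f(x,y)\|_{L^\infty_y(\mathbb{R})}\bigr\|_{L^p_x(\mathbb{R})}$$ for all Schwartz functions $f:\mathbb{R}^2\to\mathbb{C}$. -/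

import Mathlib

open MeasureTheory Filter Topology
open scoped ENNReal NNReal SchwartzMap

/-- The truncated singular integral `∫_{|z - w| > ε} K(z - w) f(w) dw` on the plane, where `|·|` is
the Euclidean norm (the norm that `ℝ × ℝ` carries in Mathlib is the maximum norm). -/
noncomputable def truncatedSingularIntegral (K : ℝ × ℝ → ℂ) (f : 𝓢(ℝ × ℝ, ℂ)) (z : ℝ × ℝ)
    (ε : ℝ) : ℂ :=
  ∫ w in {w : ℝ × ℝ | ε < √((z.1 - w.1) ^ 2 + (z.2 - w.2) ^ 2)}, K (z - w) * f w

/-- The operator `Tf(z) = lim_{ε → 0+} ∫_{|z - w| > ε} K(z - w) f(w) dw` on Schwartz functions. -/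
noncomputable def singularIntegralOperator (K : ℝ × ℝ → ℂ) (f : 𝓢(ℝ × ℝ, ℂ)) (z : ℝ × ℝ) : ℂ :=
  limUnder (𝓝[>] (0 : ℝ)) (truncatedSingularIntegral K f z)

/-- The kernel `K(x, y) = xy / (2π (x² + y²)²)`. -/
noncomputable def doubleRieszKernel (u : ℝ × ℝ) : ℝ :=
  u.1 * u.2 / (2 * Real.pi * (u.1 ^ 2 + u.2 ^ 2) ^ 2)

/-- The double Riesz transform `R₁₂`. -/
noncomputable def doubleRieszTransform (f : 𝓢(ℝ × ℝ, ℂ)) : ℝ × ℝ → ℂ :=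
  singularIntegralOperator (fun u => (doubleRieszKernel u : ℂ)) f

/-- The mixed norm `‖ ‖F(x,y)‖_{L^p_x} ‖_{L^q_y}`: the norm in `x` is taken first. -/
noncomputable def mixedNormXY (p q : ℝ≥0∞) (F : ℝ × ℝ → ℂ) : ℝ≥0∞ :=
  eLpNorm (fun y : ℝ => eLpNorm (fun x : ℝ => F (x, y)) p volume) q volume

/-- The mixed norm `‖ ‖F(x,y)‖_{L^q_y} ‖_{L^p_x}`: the norm in `y` is taken first. -/
noncomputable def mixedNormYX (q p : ℝ≥0∞) (F : ℝ × ℝ → ℂ) : ℝ≥0∞ :=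
  eLpNorm (fun x : ℝ => eLpNorm (fun y : ℝ => F (x, y)) q volume) p volume

/-- The limit that defines `R₁₂ f (z)` exists for every Schwartz function `f` and every point `z`,
so `limUnder` never takes its default value there. -/
theorem tendsto_doubleRieszTransform (f : 𝓢(ℝ × ℝ, ℂ)) (z : ℝ × ℝ) :
    Tendsto (truncatedSingularIntegral (fun u => (doubleRieszKernel u : ℂ)) f z)
      (𝓝[>] (0 : ℝ)) (𝓝 (doubleRieszTransform f z)) := by
  refine tendsto_nhds_limUnder ?_
  obtain ⟨L, hL0, hL⟩ : ∃ L : ℝ, 0 ≤ L ∧ ∀ a b : ℝ × ℝ, ‖f a - f b‖ ≤ L * ‖a - b‖ := by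
    refine ⟨SchwartzMap.seminorm ℝ 0 1 f, apply_nonneg _ _, fun a b => ?_⟩
    refine Convex.norm_image_sub_le_of_norm_fderiv_le (𝕜 := ℝ) (s := Set.univ)
      (fun x _ => f.differentiableAt) (fun x _ => ?_) convex_univ (Set.mem_univ _) (Set.mem_univ _)
    have := SchwartzMap.norm_iteratedFDeriv_le_seminorm ℝ f 1 x
    rwa [← norm_iteratedFDeriv_one]
  set k : ℝ × ℝ → ℂ := fun u => (doubleRieszKernel u : ℂ) with hk
  have hkm : Measurable k := by
    unfold k doubleRieszKernel
    fun_prop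
  set r : ℝ × ℝ → ℝ × ℝ := Prod.map (fun x => -x) id with hr
  have hrm : MeasurePreserving r volume volume :=
    (Measure.measurePreserving_neg volume).prod (MeasurePreserving.id volume)
  have hre : MeasurableEmbedding r :=
    (((MeasurableEquiv.neg ℝ).prodCongr (MeasurableEquiv.refl ℝ)).measurableEmbedding)
  set F : ℝ × ℝ → ℂ := fun u => f (z - u) with hF
  have hFi : Integrable F := by
    simpa [F] using (f.integrable (μ := volume)).comp_sub_left z
  have hFri : Integrable (fun u => F (r u)) := hrm.integrable_comp_of_integrable hFi
  have hkr : ∀ u, k (r u) = - k u := by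
    intro u
    simp [k, r, doubleRieszKernel, neg_div]
  -- bound on the kernel
  have hkb : ∀ u : ℝ × ℝ, ∀ ε : ℝ, 0 < ε → ε < √(u.1 ^ 2 + u.2 ^ 2) → ‖k u‖ ≤ 1 / ε ^ 2 := by
    intro u ε hε hu
    have h1 : ε ^ 2 < u.1 ^ 2 + u.2 ^ 2 := by
      rwa [Real.lt_sqrt hε.le] at hu
    have hpos : 0 < u.1 ^ 2 + u.2 ^ 2 := lt_trans (by positivity) h1
    simp only [k, doubleRieszKernel, Complex.norm_real, Real.norm_eq_abs, abs_div]
    rw [abs_of_pos (a := 2 * Real.pi * _) (by positivity), div_le_div_iff₀ (by positivity)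
      (by positivity)]
    have h2 : |u.1 * u.2| ≤ u.1 ^ 2 + u.2 ^ 2 := by
      rw [abs_le]; constructor <;> nlinarith [sq_nonneg (u.1 + u.2), sq_nonneg (u.1 - u.2)]
    have hpi := Real.pi_gt_three
    calc |u.1 * u.2| * ε ^ 2 ≤ (u.1 ^ 2 + u.2 ^ 2) * (u.1 ^ 2 + u.2 ^ 2) := by gcongr
      _ ≤ 1 * (2 * Real.pi * (u.1 ^ 2 + u.2 ^ 2) ^ 2) := by nlinarith [sq_nonneg (u.1 ^ 2 + u.2 ^ 2)]
  set S : ℝ → Set (ℝ × ℝ) := fun ε => {u | ε < √(u.1 ^ 2 + u.2 ^ 2)} with hS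
  have hSm : ∀ ε, MeasurableSet (S ε) := fun ε => measurableSet_lt measurable_const (by fun_prop)
  have hrS : ∀ ε u, r u ∈ S ε ↔ u ∈ S ε := by
    intro ε u; simp [S, r]
  set D : ℝ × ℝ → ℂ := fun u => k u * (F u - F (r u)) with hD
  have hint : ∀ ε, 0 < ε → ∀ G : ℝ × ℝ → ℂ, Integrable G →
      Integrable ((S ε).indicator (fun u => k u * G u)) := by
    intro ε hε G hG
    refine (hG.norm.const_mul (1 / ε ^ 2)).mono'
      ((hkm.aestronglyMeasurable.mul hG.aestronglyMeasurable).indicator (hSm ε)) ?_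
    refine Eventually.of_forall fun u => ?_
    by_cases hu : u ∈ S ε
    · rw [Set.indicator_of_mem hu, norm_mul]
      gcongr
      exact hkb u ε hε hu
    · rw [Set.indicator_of_notMem hu, norm_zero]; positivity
  have key : ∀ ε, 0 < ε → truncatedSingularIntegral k f z ε =
      (1 / 2) * ∫ u, (S ε).indicator D u := by
    intro ε hε
    have e1 : truncatedSingularIntegral k f z ε =
        ∫ u, (S ε).indicator (fun u => k u * F u) u := by
      unfold truncatedSingularIntegral
      rw [← integral_indicator (measurableSet_lt measurable_const (by fun_prop)),
        ← integral_sub_left_eq_self _ volume z]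
      congr 1
      ext u
      simp [Set.indicator_apply, S, F]
    have e2 : ∫ u, (S ε).indicator (fun u => k u * F u) u =
        - ∫ u, (S ε).indicator (fun u => k u * F (r u)) u := by
      rw [← hrm.integral_comp hre, ← integral_neg]
      congr 1
      ext u
      by_cases hu : u ∈ S ε
      · rw [Set.indicator_of_mem hu, Set.indicator_of_mem ((hrS ε u).2 hu), hkr, neg_mul]
      · rw [Set.indicator_of_notMem hu, Set.indicator_of_notMem (fun h => hu ((hrS ε u).1 h)),
          neg_zero]
    have e3 : ∫ u, (S ε).indicator D u = (∫ u, (S ε).indicator (fun u => k u * F u) u) -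
        ∫ u, (S ε).indicator (fun u => k u * F (r u)) u := by
      rw [← integral_sub (hint ε hε _ hFi) (hint ε hε _ hFri)]
      congr 1
      ext u
      by_cases hu : u ∈ S ε
      · simp [hu, D, mul_sub]
      · simp [hu]
    rw [e3, e1]
    linear_combination (1 / 2) * e2
  -- an integrable majorant
  set φ : ℝ → ℝ := (Set.Icc (-1) 1).indicator (fun x => |x| ^ (-(1 / 2) : ℝ)) with hφ
  have hφi : Integrable φ := by
    rw [hφ, integrable_indicator_iff measurableSet_Icc]
    have h := (intervalIntegral.intervalIntegrable_rpow' (a := 0) (b := 1)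
      (r := -(1 / 2)) (by norm_num))
    have h1 : IntegrableOn (fun x : ℝ => |x| ^ (-(1 / 2) : ℝ)) (Set.Ioc 0 1) := by
      rw [intervalIntegrable_iff_integrableOn_Ioc_of_le zero_le_one] at h
      refine h.congr_fun (fun x hx => ?_) measurableSet_Ioc
      simp only
      rw [abs_of_pos hx.1]
    have h2 : IntegrableOn (fun x : ℝ => |x| ^ (-(1 / 2) : ℝ)) (Set.Icc 0 1) :=
      (integrableOn_Icc_iff_integrableOn_Ioc).2 h1
    have h3 : IntegrableOn (fun x : ℝ => |x| ^ (-(1 / 2) : ℝ)) (Set.Icc (-1) 0) := by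
      have := h2.comp_neg
      simpa using this
    rw [← Set.Icc_union_Icc_eq_Icc (b := (0 : ℝ)) (by norm_num) (by norm_num)]
    exact h3.union h2
  have hφ0 : ∀ x, 0 ≤ φ x := fun x => Set.indicator_nonneg (fun x _ => by positivity) x
  set B : ℝ × ℝ → ℝ := fun u => 2 * L * (φ u.1 * φ u.2) + (‖F u‖ + ‖F (r u)‖) with hB
  have hBi : Integrable B := ((hφi.mul_prod hφi).const_mul _).add (hFi.norm.add hFri.norm)
  have hDB : ∀ u, ‖D u‖ ≤ B u := by
    intro u
    have hDn : ‖D u‖ = ‖k u‖ * ‖F u - F (r u)‖ := norm_mul _ _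
    by_cases h0 : u.1 = 0 ∨ u.2 = 0
    · have : k u = 0 := by
        rcases h0 with h | h <;> simp [k, doubleRieszKernel, h]
      rw [hDn, this, norm_zero, zero_mul]
      have := hφ0 u.1
      have := hφ0 u.2
      positivity
    push Not at h0
    by_cases hu : u.1 ∈ Set.Icc (-1 : ℝ) 1 ∧ u.2 ∈ Set.Icc (-1 : ℝ) 1
    · have hd : ‖F u - F (r u)‖ ≤ L * (2 * |u.1|) := by
        refine (hL _ _).trans (le_of_eq ?_)
        congr 1
        have : z - u - (z - r u) = (-2 * u.1, 0) := by
          ext <;> simp [r]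
          ring
        rw [this, Prod.norm_def]
        simp
      have ha : 0 < |u.1| := abs_pos.2 h0.1
      have hb : 0 < |u.2| := abs_pos.2 h0.2
      have hφφ : φ u.1 * φ u.2 = (√(|u.1| * |u.2|))⁻¹ := by
        rw [hφ, Set.indicator_of_mem hu.1, Set.indicator_of_mem hu.2,
          ← Real.mul_rpow (abs_nonneg _) (abs_nonneg _), Real.rpow_neg (by positivity),
          Real.sqrt_eq_rpow]
      have hkn : ‖k u‖ * |u.1| ≤ (√(|u.1| * |u.2|))⁻¹ := by
        simp only [k, doubleRieszKernel, Complex.norm_real, Real.norm_eq_abs, abs_div]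
        rw [abs_mul u.1, ← sq_abs u.1, ← sq_abs u.2]
        generalize |u.1| = a at *
        generalize |u.2| = b at *
        rw [abs_of_pos (a := 2 * Real.pi * _) (by positivity), div_mul_eq_mul_div,
          ← one_div, div_le_div_iff₀ (by positivity) (by positivity)]
        have hpi := Real.pi_gt_three
        have hs : √(a * b) ≤ a + b := by
          rw [Real.sqrt_le_left (by positivity)]
          nlinarith
        have h2 : a * b * a * (a + b) ≤ (a ^ 2 + b ^ 2) ^ 2 * 2 := by
          nlinarith [sq_nonneg (a ^ 2 - b ^ 2), sq_nonneg (a - b), mul_pos ha hb,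
            mul_nonneg (mul_pos ha hb).le (sq_nonneg (a - b)), sq_nonneg (a*b), sq_nonneg (b ^ 2),
            sq_nonneg (a * (a - b))]
        calc a * b * a * √(a * b) ≤ a * b * a * (a + b) := by gcongr
          _ ≤ (a ^ 2 + b ^ 2) ^ 2 * 2 := h2
          _ ≤ 1 * (2 * Real.pi * (a ^ 2 + b ^ 2) ^ 2) := by nlinarith [sq_nonneg (a ^ 2 + b ^ 2)]
      rw [hDn]
      calc ‖k u‖ * ‖F u - F (r u)‖ ≤ ‖k u‖ * (L * (2 * |u.1|)) := by gcongr
        _ = 2 * L * (‖k u‖ * |u.1|) := by ring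
        _ ≤ 2 * L * (φ u.1 * φ u.2) := by rw [hφφ]; gcongr
        _ ≤ B u := by simp only [B]; linarith [norm_nonneg (F u), norm_nonneg (F (r u))]
    · have h1 : 1 < u.1 ^ 2 + u.2 ^ 2 := by
        by_contra hcon
        push Not at hcon
        refine hu ⟨abs_le.1 (abs_le_one_iff_mul_self_le_one.2 ?_),
          abs_le.1 (abs_le_one_iff_mul_self_le_one.2 ?_)⟩ <;> nlinarith [sq_nonneg u.1, sq_nonneg u.2]
      have hk1 : ‖k u‖ ≤ 1 := by
        simpa using hkb u 1 one_pos ((Real.lt_sqrt zero_le_one).2 (by simpa using h1))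
      rw [hDn]
      calc ‖k u‖ * ‖F u - F (r u)‖ ≤ 1 * (‖F u‖ + ‖F (r u)‖) := by
            gcongr; exact norm_sub_le _ _
        _ ≤ B u := by
          have := mul_nonneg (hφ0 u.1) (hφ0 u.2)
          have := mul_nonneg hL0 this
          simp only [B]; linarith
  have hDm : AEStronglyMeasurable D volume :=
    hkm.aestronglyMeasurable.mul (hFi.sub hFri).aestronglyMeasurable
  refine ⟨(1 / 2) * ∫ u, D u, ?_⟩
  have hlim : Tendsto (fun ε => ∫ u, (S ε).indicator D u) (𝓝[>] (0 : ℝ)) (𝓝 (∫ u, D u)) := by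
    refine tendsto_integral_filter_of_dominated_convergence B
      (Eventually.of_forall fun ε => hDm.indicator (hSm ε))
      (Eventually.of_forall fun ε => Eventually.of_forall fun u =>
        (norm_indicator_le_norm_self _ _).trans (hDB u)) hBi ?_
    refine Eventually.of_forall fun u => ?_
    by_cases hu : u.1 ^ 2 + u.2 ^ 2 = 0
    · have h1 : u.1 = 0 := by nlinarith [sq_nonneg u.1, sq_nonneg u.2]
      have h0 : D u = 0 := by simp [D, k, doubleRieszKernel, h1]
      refine tendsto_const_nhds.congr fun ε => ?_
      by_cases h : u ∈ S ε <;> simp [h, h0]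
    · have hp : 0 < √(u.1 ^ 2 + u.2 ^ 2) := Real.sqrt_pos.2 (by positivity)
      refine tendsto_const_nhds.congr' ?_
      filter_upwards [nhdsWithin_le_nhds (Iio_mem_nhds hp)] with ε hε
      exact (Set.indicator_of_mem (show u ∈ S ε from hε) D).symm
  refine (hlim.const_mul (1 / 2)).congr' ?_
  filter_upwards [self_mem_nhdsWithin] with ε hε
  exact (key ε hε).symm

/-! Since `K` is `-(1/2) ∂₁∂₂` of the fundamental solution of the Laplacian, `R₁₂ (Δg) = -(1/2)
∂₁∂₂g` for every test function `g` (`doubleRieszTransform_laplacian`). It therefore suffices to find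
`g` with `Δg` bounded and supported in a fixed vertical strip, while `∂₁∂₂g` is large in `L^p_x` for
all small `y`.

Take `g = ∑ exp(i l_j x) χ(x) l_j⁻² η(l_j y)` over `j < N`, with `l_j = 2π 2^j`, `χ` a cutoff and
`η(t) = t χ(t)`. Up to errors `O(1/l_j)`, the `j`-th term of `Δg` is `exp(i l_j x) χ(x) b(l_j y)`
with `b = η'' - η`. As `b` vanishes at `0` and has compact support, the sum over the dyadic scales
stays bounded uniformly in `y` and `N` (`sum_norm_dyadic_dilates_le`). But `η' = 1` near `0`, so
near the `x`-axis `∂₁∂₂g` is `i ∑ exp(i l_j x)`: no decay separates the scales. By orthogonality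
this sum has `L²(0,1)` norm `√N`, hence `L^p(0,1)` norm at least `√N`
(`sqrt_le_eLpNorm_lacunary_sum`). The left side grows like `√N` and the right side stays bounded. -/

/-! ### The double Riesz transform of a Laplacian. -/

/-- Green's identity for the kernel `xy / (x² + y²)²` outside a disc, in polar coordinates: if
`A`, `B`, `W` play the role of `∂₁²g`, `∂₂²g`, `∂₁∂₂g`, the integral of `sin 2θ / r * Δg` over an
annular region reduces to integrals over its boundary circles. -/
theorem integral_polar_kernel_eq_boundary {A B W : ℝ × ℝ → ℂ} (hA : ContDiff ℝ 1 A)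
    (hB : ContDiff ℝ 1 B) (hW : ContDiff ℝ 1 W)
    (hAW : ∀ z, fderiv ℝ A z (0, 1) = fderiv ℝ W z (1, 0))
    (hBW : ∀ z, fderiv ℝ B z (1, 0) = fderiv ℝ W z (0, 1))
    {ε M : ℝ} (hε : 0 < ε) (hM : ε ≤ M)
    (hA0 : ∀ θ, A (M * Real.cos θ, M * Real.sin θ) = 0)
    (hB0 : ∀ θ, B (M * Real.cos θ, M * Real.sin θ) = 0)
    (hW0 : ∀ θ, W (M * Real.cos θ, M * Real.sin θ) = 0) :
    ∫ r in ε..M, ∫ θ in (-Real.pi)..Real.pi,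
        ((2 * Real.sin θ * Real.cos θ / r : ℝ) : ℂ) *
          (A (r * Real.cos θ, r * Real.sin θ) + B (r * Real.cos θ, r * Real.sin θ)) =
      -∫ θ in (-Real.pi)..Real.pi, (W (ε * Real.cos θ, ε * Real.sin θ) -
        ((Real.sin θ * Real.cos θ : ℝ) : ℂ) *
          (A (ε * Real.cos θ, ε * Real.sin θ) + B (ε * Real.cos θ, ε * Real.sin θ))) := by
  set P : ℝ × ℝ → ℝ × ℝ := fun q => (q.1 * Real.cos q.2, q.1 * Real.sin q.2) with hP
  -- The integrand is the divergence `∂_r F + ∂_θ G` in the variables `(r, θ)`. The compatibility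
  -- relations `hAW`, `hBW` and `sin² + cos² = 1` make all derivatives of `A`, `B`, `W` cancel.
  set F : ℝ × ℝ → ℂ := fun q => W (P q) -
    ((Real.sin q.2 * Real.cos q.2 : ℝ) : ℂ) * (A (P q) + B (P q)) with hF
  set G : ℝ × ℝ → ℂ := fun q => -((q.1⁻¹ : ℝ) : ℂ) *
    (((Real.cos q.2 ^ 2 : ℝ) : ℂ) * A (P q) - ((Real.sin q.2 ^ 2 : ℝ) : ℂ) * B (P q)) with hG
  have hPs : ContDiff ℝ 1 P := by
    have h1 : ContDiff ℝ 1 fun q : ℝ × ℝ => q.1 * Real.cos q.2 :=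
      contDiff_fst.mul (Real.contDiff_cos.comp contDiff_snd)
    have h2 : ContDiff ℝ 1 fun q : ℝ × ℝ => q.1 * Real.sin q.2 :=
      contDiff_fst.mul (Real.contDiff_sin.comp contDiff_snd)
    exact h1.prodMk h2
  have hPc := hPs.continuous
  have hAc := hA.continuous
  have hBc := hB.continuous
  have hWc := hW.continuous
  have hFd : Differentiable ℝ F := by
    have a1 := (hA.differentiable one_ne_zero).comp (hPs.differentiable one_ne_zero)
    have a2 := (hB.differentiable one_ne_zero).comp (hPs.differentiable one_ne_zero)
    have a3 := (hW.differentiable one_ne_zero).comp (hPs.differentiable one_ne_zero)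
    have a4 : Differentiable ℝ fun q : ℝ × ℝ => ((Real.sin q.2 * Real.cos q.2 : ℝ) : ℂ) :=
      Complex.ofRealCLM.differentiable.comp
        (show Differentiable ℝ fun q : ℝ × ℝ => Real.sin q.2 * Real.cos q.2 by fun_prop)
    exact a3.sub (a4.mul (a1.add a2))
  have hGd : ∀ q : ℝ × ℝ, 0 < q.1 → DifferentiableAt ℝ G q := by
    intro q hq
    have a1 := (hA.differentiable one_ne_zero).comp (hPs.differentiable one_ne_zero)
    have a2 := (hB.differentiable one_ne_zero).comp (hPs.differentiable one_ne_zero)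
    have a4 : Differentiable ℝ fun q : ℝ × ℝ => ((Real.cos q.2 ^ 2 : ℝ) : ℂ) :=
      Complex.ofRealCLM.differentiable.comp
        (show Differentiable ℝ fun q : ℝ × ℝ => Real.cos q.2 ^ 2 by fun_prop)
    have a5 : Differentiable ℝ fun q : ℝ × ℝ => ((Real.sin q.2 ^ 2 : ℝ) : ℂ) :=
      Complex.ofRealCLM.differentiable.comp
        (show Differentiable ℝ fun q : ℝ × ℝ => Real.sin q.2 ^ 2 by fun_prop)
    have a6 : DifferentiableAt ℝ (fun q : ℝ × ℝ => ((q.1⁻¹ : ℝ) : ℂ)) q :=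
      Complex.ofRealCLM.differentiableAt.comp q
        (DifferentiableAt.inv differentiableAt_fst hq.ne')
    exact a6.neg.mul (((a4 q).mul (a1 q)).sub ((a5 q).mul (a2 q)))
  have split : ∀ (X : ℝ × ℝ → ℂ) (z : ℝ × ℝ) (a b : ℝ),
      fderiv ℝ X z (a, b) = (a : ℂ) * fderiv ℝ X z (1, 0) + (b : ℂ) * fderiv ℝ X z (0, 1) := by
    intro X z a b
    have : ((a, b) : ℝ × ℝ) = a • (1, 0) + b • (0, 1) := by simp
    rw [this, map_add, map_smul, map_smul]
    simp
  have dr : ∀ (X : ℝ × ℝ → ℂ), ContDiff ℝ 1 X → ∀ r θ : ℝ, HasDerivAt (fun s => X (P (s, θ)))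
      ((Real.cos θ : ℂ) * fderiv ℝ X (P (r, θ)) (1, 0) +
        (Real.sin θ : ℂ) * fderiv ℝ X (P (r, θ)) (0, 1)) r := by
    intro X hX r θ
    have h1 : HasDerivAt (fun s => P (s, θ)) (Real.cos θ, Real.sin θ) r := by
      simpa using ((hasDerivAt_id r).mul_const (Real.cos θ)).prodMk
        ((hasDerivAt_id r).mul_const (Real.sin θ))
    have h2 := ((hX.differentiable one_ne_zero) (P (r, θ))).hasFDerivAt.comp_hasDerivAt r h1
    rw [split] at h2
    exact_mod_cast h2
  have dθ : ∀ (X : ℝ × ℝ → ℂ), ContDiff ℝ 1 X → ∀ r θ : ℝ, HasDerivAt (fun s => X (P (r, s)))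
      (-(r * Real.sin θ : ℂ) * fderiv ℝ X (P (r, θ)) (1, 0) +
        (r * Real.cos θ : ℂ) * fderiv ℝ X (P (r, θ)) (0, 1)) θ := by
    intro X hX r θ
    have h1 : HasDerivAt (fun s => P (r, s)) (r * (-Real.sin θ), r * Real.cos θ) θ :=
      ((Real.hasDerivAt_cos θ).const_mul r).prodMk
        ((Real.hasDerivAt_sin θ).const_mul r)
    have h2 := ((hX.differentiable one_ne_zero) (P (r, θ))).hasFDerivAt.comp_hasDerivAt θ h1
    rw [split] at h2
    refine h2.congr_deriv ?_
    push_cast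
    ring
  have div_eq : ∀ q : ℝ × ℝ, 0 < q.1 → fderiv ℝ F q (1, 0) + fderiv ℝ G q (0, 1) =
      ((2 * Real.sin q.2 * Real.cos q.2 / q.1 : ℝ) : ℂ) * (A (P q) + B (P q)) := by
    rintro ⟨r, θ⟩ hr
    simp only at hr
    have hr' : (r : ℂ) ≠ 0 := by exact_mod_cast hr.ne'
    have e1 := ((hFd (r, θ)).hasFDerivAt.comp_hasDerivAt r
      ((hasDerivAt_id r).prodMk (hasDerivAt_const r θ))).unique ((dr W hW r θ).sub
        (((dr A hA r θ).add (dr B hB r θ)).const_mul ((Real.sin θ * Real.cos θ : ℝ) : ℂ)))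
    have e2 := ((hGd (r, θ) hr).hasFDerivAt.comp_hasDerivAt θ
      ((hasDerivAt_const θ r).prodMk (hasDerivAt_id θ))).unique
        (((((Real.hasDerivAt_cos θ).pow 2).ofReal_comp.mul (dθ A hA r θ)).sub
          (((Real.hasDerivAt_sin θ).pow 2).ofReal_comp.mul (dθ B hB r θ))).const_mul
            (-((r⁻¹ : ℝ) : ℂ)))
    rw [e1, e2, hAW, hBW]
    have hsc : (Real.sin θ : ℂ) ^ 2 + (Real.cos θ : ℂ) ^ 2 = 1 := by
      exact_mod_cast Real.sin_sq_add_cos_sq θ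
    simp only [Pi.pow_apply]
    push_cast at hsc ⊢
    field_simp
    generalize Complex.sin θ = s at *
    generalize Complex.cos θ = c at *
    generalize fderiv ℝ W (P (r, θ)) (1, 0) = Wx
    generalize fderiv ℝ W (P (r, θ)) (0, 1) = Wy
    linear_combination (-((r : ℂ) * (c * Wx + s * Wy))) * hsc
  have hbox : ∀ q ∈ Set.uIcc ε M ×ˢ Set.uIcc (-Real.pi) Real.pi, 0 < q.1 := by
    rintro q ⟨hq, -⟩
    rw [Set.uIcc_of_le hM] at hq
    exact hε.trans_le hq.1
  have hGc : ContinuousOn G (Set.uIcc ε M ×ˢ Set.uIcc (-Real.pi) Real.pi) :=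
    fun q hq => (hGd q (hbox q hq)).continuousAt.continuousWithinAt
  have key := integral2_divergence_prod_of_hasFDerivAt F G (fderiv ℝ F) (fderiv ℝ G)
    ε (-Real.pi) M Real.pi hFd.continuous.continuousOn hGc
    (fun q _ => (hFd q).hasFDerivAt)
    (fun q hq => (hGd q (by
      have := hq.1.1
      rw [min_eq_left hM] at this
      exact hε.trans this)).hasFDerivAt)
    (by
      refine ContinuousOn.integrableOn_compact (isCompact_uIcc.prod isCompact_uIcc) ?_
      refine ContinuousOn.congr (f := fun q : ℝ × ℝ =>
        ((2 * Real.sin q.2 * Real.cos q.2 / q.1 : ℝ) : ℂ) * (A (P q) + B (P q))) ?_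
        (fun q hq => div_eq q (hbox q hq))
      refine ContinuousOn.mul (Complex.continuous_ofReal.comp_continuousOn
        (ContinuousOn.div (by fun_prop) (by fun_prop) fun q hq => (hbox q hq).ne')) ?_
      fun_prop)
  -- Of the four sides of the rectangle only `r = ε` contributes: `F` vanishes at `r = M`, and the
  -- sides `θ = ±π` cancel by periodicity.
  have hFM : ∀ θ, F (M, θ) = 0 := fun θ => by simp [hF, hP, hA0, hB0, hW0]
  have hGπ : ∀ r, G (r, Real.pi) = G (r, -Real.pi) := fun r => by simp [hG, hP]
  simp only [hFM, hGπ, sub_self, intervalIntegral.integral_zero, zero_add, zero_sub] at key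
  rw [← key]
  refine intervalIntegral.integral_congr fun r hr => ?_
  refine intervalIntegral.integral_congr fun θ hθ => ?_
  exact (div_eq (r, θ) (hbox (r, θ) ⟨hr, hθ⟩)).symm

/-- The extra factor `r` is the Jacobian of polar coordinates. -/
theorem doubleRieszKernel_polar (r θ : ℝ) (hr : r ≠ 0) :
    r * doubleRieszKernel (r * Real.cos θ, r * Real.sin θ) =
      1 / (4 * Real.pi) * (2 * Real.sin θ * Real.cos θ / r) := by
  have h : (r * Real.cos θ) ^ 2 + (r * Real.sin θ) ^ 2 = r ^ 2 := by
    linear_combination r ^ 2 * Real.cos_sq_add_sin_sq θ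
  have := Real.pi_ne_zero
  simp only [doubleRieszKernel, h]
  field_simp
  ring

theorem sqrt_polar {r : ℝ} (hr : 0 ≤ r) (θ : ℝ) :
    √((r * Real.cos θ) ^ 2 + (r * Real.sin θ) ^ 2) = r := by
  have h : (r * Real.cos θ) ^ 2 + (r * Real.sin θ) ^ 2 = r ^ 2 := by
    linear_combination r ^ 2 * Real.cos_sq_add_sin_sq θ
  rw [h, Real.sqrt_sq hr]

theorem HasCompactSupport.exists_polar_eq_zero {X : ℝ × ℝ → ℂ} (hX : HasCompactSupport X) :
    ∃ M : ℝ, ∀ r, M ≤ r → ∀ θ, X (r * Real.cos θ, r * Real.sin θ) = 0 := by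
  obtain ⟨R, hR⟩ := hX.isCompact.isBounded.subset_closedBall 0
  -- The ball is a square for the maximum norm, so membership only gives `r² ≤ 2R²`; any radius
  -- beyond `√2 |R|` would do.
  refine ⟨2 * |R| + 1, fun r hr θ => ?_⟩
  by_contra hne
  have hmem := hR (subset_tsupport X hne)
  rw [mem_closedBall_zero_iff, Prod.norm_def, max_le_iff, Real.norm_eq_abs, Real.norm_eq_abs]
    at hmem
  have h1 := abs_le.1 (hmem.1.trans (le_abs_self R))
  have h2 := abs_le.1 (hmem.2.trans (le_abs_self R))
  have h : (r * Real.cos θ) ^ 2 + (r * Real.sin θ) ^ 2 = r ^ 2 := by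
    linear_combination r ^ 2 * Real.cos_sq_add_sin_sq θ
  have h3 : (r * Real.cos θ) ^ 2 ≤ |R| ^ 2 := sq_le_sq' h1.1 h1.2
  have h4 : (r * Real.sin θ) ^ 2 ≤ |R| ^ 2 := sq_le_sq' h2.1 h2.2
  nlinarith [abs_nonneg R]

/-- The truncated integral of `K * Δg` at the origin is an integral over the circle of radius
`ε`; here `A`, `B`, `W` play the role of `∂₁²g`, `∂₂²g`, `∂₁∂₂g`. -/
theorem integral_truncated_kernel_eq {A B W : ℝ × ℝ → ℂ} (hA : ContDiff ℝ 1 A)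
    (hB : ContDiff ℝ 1 B) (hW : ContDiff ℝ 1 W) (hAs : HasCompactSupport A)
    (hBs : HasCompactSupport B) (hWs : HasCompactSupport W)
    (hAW : ∀ z, fderiv ℝ A z (0, 1) = fderiv ℝ W z (1, 0))
    (hBW : ∀ z, fderiv ℝ B z (1, 0) = fderiv ℝ W z (0, 1)) {ε : ℝ} (hε : 0 < ε) :
    ∫ u, {u : ℝ × ℝ | ε < √(u.1 ^ 2 + u.2 ^ 2)}.indicator
        (fun u => (doubleRieszKernel u : ℂ) * (A u + B u)) u =
      -((1 / (4 * Real.pi) : ℝ) : ℂ) * ∫ θ in (-Real.pi)..Real.pi,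
        (W (ε * Real.cos θ, ε * Real.sin θ) - ((Real.sin θ * Real.cos θ : ℝ) : ℂ) *
          (A (ε * Real.cos θ, ε * Real.sin θ) + B (ε * Real.cos θ, ε * Real.sin θ))) := by
  obtain ⟨M₁, h₁⟩ := hAs.exists_polar_eq_zero
  obtain ⟨M₂, h₂⟩ := hBs.exists_polar_eq_zero
  obtain ⟨M₃, h₃⟩ := hWs.exists_polar_eq_zero
  obtain ⟨M, hM, hM₁, hM₂, hM₃⟩ : ∃ M, ε ≤ M ∧ M₁ ≤ M ∧ M₂ ≤ M ∧ M₃ ≤ M :=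
    ⟨max (max ε M₁) (max M₂ M₃), by simp, by simp, by simp, by simp⟩
  have hgreen := integral_polar_kernel_eq_boundary hA hB hW hAW hBW hε hM
    (h₁ M hM₁) (h₂ M hM₂) (h₃ M hM₃)
  have hAc := hA.continuous
  have hBc := hB.continuous
  have hπ : -Real.pi ≤ Real.pi := by linarith [Real.pi_pos]
  rw [neg_mul, ← mul_neg, ← hgreen, ← integral_comp_polarCoord_symm,
    intervalIntegral.integral_of_le hM]
  simp_rw [intervalIntegral.integral_of_le hπ, integral_Ioc_eq_integral_Ioo (x := -Real.pi)]
  rw [← setIntegral_prod (fun q : ℝ × ℝ => ((2 * Real.sin q.2 * Real.cos q.2 / q.1 : ℝ) : ℂ) *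
    (A (q.1 * Real.cos q.2, q.1 * Real.sin q.2) + B (q.1 * Real.cos q.2, q.1 * Real.sin q.2))),
    ← integral_const_mul]
  · have hsub : Set.Ioc ε M ×ˢ Set.Ioo (-Real.pi) Real.pi ⊆ polarCoord.target := by
      rintro q ⟨hq, hq'⟩
      exact ⟨hε.trans hq.1, hq'⟩
    rw [setIntegral_eq_of_subset_of_forall_sdiff_eq_zero
      polarCoord.open_target.measurableSet hsub]
    · refine setIntegral_congr_fun (measurableSet_Ioc.prod measurableSet_Ioo) ?_
      rintro ⟨r, θ⟩ ⟨hr, hθ⟩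
      have hr0 : 0 < r := hε.trans hr.1
      have hmem : polarCoord.symm (r, θ) ∈ {u : ℝ × ℝ | ε < √(u.1 ^ 2 + u.2 ^ 2)} := by
        simpa [polarCoord_symm_apply, sqrt_polar hr0.le] using hr.1
      simp only
      rw [Set.indicator_of_mem hmem, polarCoord_symm_apply, Complex.real_smul, ← mul_assoc,
        ← mul_assoc, ← Complex.ofReal_mul, ← Complex.ofReal_mul,
        doubleRieszKernel_polar r θ hr0.ne']
    · rintro ⟨r, θ⟩ ⟨hr, hn⟩
      have hr0 : 0 < r := hr.1
      by_cases hrε : ε < r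
      · have hrM : M ≤ r := by
          by_contra hcon
          exact hn ⟨⟨hrε, (not_le.1 hcon).le⟩, hr.2⟩
        rw [Set.indicator_apply_eq_zero.2, smul_zero]
        intro _
        simp [polarCoord_symm_apply, h₁ r (hM₁.trans hrM) θ, h₂ r (hM₂.trans hrM) θ]
      · rw [Set.indicator_of_notMem, smul_zero]
        simpa [polarCoord_symm_apply, sqrt_polar hr0.le] using hrε
  · refine IntegrableOn.mono_set (t := Set.Icc ε M ×ˢ Set.Icc (-Real.pi) Real.pi) ?_
      (Set.prod_mono Set.Ioc_subset_Icc_self Set.Ioo_subset_Icc_self)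
    refine ContinuousOn.integrableOn_compact (isCompact_Icc.prod isCompact_Icc) ?_
    refine ContinuousOn.mul (Complex.continuous_ofReal.comp_continuousOn
      (ContinuousOn.div (by fun_prop) (by fun_prop) fun q hq => (hε.trans_le hq.1.1).ne')) ?_
    fun_prop

/-- If `A`, `B`, `W` play the role of `∂₁²g`, `∂₂²g`, `∂₁∂₂g`, then
`R₁₂ (Δg) = - ∂₁∂₂g / 2`. -/
theorem doubleRieszTransform_laplacian {A B W : ℝ × ℝ → ℂ} (hA : ContDiff ℝ 1 A)
    (hB : ContDiff ℝ 1 B) (hW : ContDiff ℝ 1 W) (hAs : HasCompactSupport A)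
    (hBs : HasCompactSupport B) (hWs : HasCompactSupport W)
    (hAW : ∀ z, fderiv ℝ A z (0, 1) = fderiv ℝ W z (1, 0))
    (hBW : ∀ z, fderiv ℝ B z (1, 0) = fderiv ℝ W z (0, 1))
    (f : 𝓢(ℝ × ℝ, ℂ)) (hf : ∀ z, f z = A z + B z) (z : ℝ × ℝ) :
    doubleRieszTransform f z = -(1 / 2) * W z := by
  have hs : ContDiff ℝ 1 fun u : ℝ × ℝ => z - u := contDiff_const.sub contDiff_id
  have hcs : ∀ {X : ℝ × ℝ → ℂ}, HasCompactSupport X → HasCompactSupport fun u => X (z - u) :=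
    fun hX => hX.comp_homeomorph (Homeomorph.subLeft z)
  have hd : ∀ {X : ℝ × ℝ → ℂ}, ContDiff ℝ 1 X → ∀ u v,
      fderiv ℝ (fun u => X (z - u)) u v = -fderiv ℝ X (z - u) v := by
    intro X hX u v
    have h := ((hX.differentiable one_ne_zero) (z - u)).hasFDerivAt.comp u
      ((hasFDerivAt_id u).const_sub z)
    have h' : fderiv ℝ (fun u => X (z - u)) u = _ := h.fderiv
    rw [h']
    simp
  have htr : ∀ ε, 0 < ε →
      truncatedSingularIntegral (fun u => (doubleRieszKernel u : ℂ)) f z ε =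
      -((1 / (4 * Real.pi) : ℝ) : ℂ) * ∫ θ in (-Real.pi)..Real.pi,
        (W (z - (ε * Real.cos θ, ε * Real.sin θ)) - ((Real.sin θ * Real.cos θ : ℝ) : ℂ) *
          (A (z - (ε * Real.cos θ, ε * Real.sin θ)) +
            B (z - (ε * Real.cos θ, ε * Real.sin θ)))) := by
    intro ε hε
    rw [← integral_truncated_kernel_eq (A := fun u => A (z - u))
      (B := fun u => B (z - u)) (W := fun u => W (z - u)) (hA.comp hs) (hB.comp hs)
      (hW.comp hs) (hcs hAs) (hcs hBs) (hcs hWs) (fun u => by rw [hd hA, hd hW, hAW]) (fun u => by rw [hd hB, hd hW, hBW]) hε]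
    unfold truncatedSingularIntegral
    rw [← integral_indicator (measurableSet_lt measurable_const (by fun_prop)),
      ← integral_sub_left_eq_self _ volume z]
    congr 1
    ext u
    simp [Set.indicator_apply, hf]
  have hAc := hA.continuous
  have hBc := hB.continuous
  have hWc := hW.continuous
  have hcont : Continuous fun ε : ℝ => -((1 / (4 * Real.pi) : ℝ) : ℂ) *
      ∫ θ in (-Real.pi)..Real.pi,
        (W (z - (ε * Real.cos θ, ε * Real.sin θ)) - ((Real.sin θ * Real.cos θ : ℝ) : ℂ) *
          (A (z - (ε * Real.cos θ, ε * Real.sin θ)) +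
            B (z - (ε * Real.cos θ, ε * Real.sin θ)))) := by
    -- The circle integral is continuous up to `ε = 0`, so the limit is found by putting `ε = 0`.
    refine continuous_const.mul
      (intervalIntegral.continuous_parametric_intervalIntegral_of_continuous' ?_ _ _)
    simp only [Function.uncurry_def]
    fun_prop
  have hlim := (hcont.tendsto 0).mono_left (nhdsWithin_le_nhds (s := Set.Ioi 0))
  have hR := (tendsto_doubleRieszTransform f z).congr'
    (by filter_upwards [self_mem_nhdsWithin] with ε hε using htr ε hε)
  rw [tendsto_nhds_unique hR hlim]
  -- The angular factor has mean zero, so `A + B` drops out at `ε = 0`, and `W` contributes `-(1 /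
  -- 4π) · 2π W z`.
  have hsc : ∫ θ in (-Real.pi)..Real.pi, ((Real.sin θ * Real.cos θ : ℝ) : ℂ) = 0 := by
    rw [intervalIntegral.integral_ofReal, integral_sin_mul_cos₁]
    simp
  have hz : z - ((0 : ℝ), (0 : ℝ)) = z := sub_zero z
  simp only [zero_mul, hz]
  rw [intervalIntegral.integral_sub (by simp)
    (Continuous.intervalIntegrable (by fun_prop) _ _), intervalIntegral.integral_mul_const, hsc,
    intervalIntegral.integral_const]
  have hπ : (Real.pi : ℂ) ≠ 0 := by exact_mod_cast Real.pi_ne_zero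
  simp only [Complex.real_smul]
  push_cast
  field_simp
  ring

/-! ### Finite sums of tensor products. -/

theorem fderiv_mul_fst_snd_apply {U V : ℝ → ℂ} (hU : Differentiable ℝ U) (hV : Differentiable ℝ V)
    (z h : ℝ × ℝ) :
    fderiv ℝ (fun z : ℝ × ℝ => U z.1 * V z.2) z h =
      h.1 * (deriv U z.1 * V z.2) + h.2 * (U z.1 * deriv V z.2) := by
  have h1 := (hU z.1).hasDerivAt.hasFDerivAt.comp z hasFDerivAt_fst
  have h2 := (hV z.2).hasDerivAt.hasFDerivAt.comp z hasFDerivAt_snd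
  have h3 : fderiv ℝ (fun z : ℝ × ℝ => U z.1 * V z.2) z = _ := (h1.mul h2).fderiv
  rw [h3]
  simp
  ring

theorem HasCompactSupport.sum_mul_fst_snd {ι : Type*} (s : Finset ι) {U V : ι → ℝ → ℂ}
    (hU : ∀ j, HasCompactSupport (U j)) (hV : ∀ j, HasCompactSupport (V j)) :
    HasCompactSupport fun z : ℝ × ℝ => ∑ j ∈ s, U j z.1 * V j z.2 := by
  refine HasCompactSupport.intro
    (K := ⋃ j ∈ s, tsupport (U j) ×ˢ tsupport (V j))
    (s.isCompact_biUnion fun j _ => (hU j).isCompact.prod (hV j).isCompact) fun z hz => ?_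
  refine Finset.sum_eq_zero fun j hj => ?_
  by_contra hne
  refine hz (Set.mem_biUnion (Finset.mem_coe.2 hj) ⟨subset_tsupport _ ?_, subset_tsupport _ ?_⟩)
  · exact left_ne_zero_of_mul hne
  · exact right_ne_zero_of_mul hne

theorem contDiff_sum_mul_fst_snd {ι : Type*} (s : Finset ι) {U V : ι → ℝ → ℂ} {n : WithTop ℕ∞}
    (hU : ∀ j, ContDiff ℝ n (U j)) (hV : ∀ j, ContDiff ℝ n (V j)) :
    ContDiff ℝ n fun z : ℝ × ℝ => ∑ j ∈ s, U j z.1 * V j z.2 :=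
  ContDiff.sum fun j _ => ((hU j).comp contDiff_fst).mul ((hV j).comp contDiff_snd)

theorem fderiv_sum_mul_fst_snd_apply {ι : Type*} (s : Finset ι) {U V : ι → ℝ → ℂ}
    (hU : ∀ j, Differentiable ℝ (U j)) (hV : ∀ j, Differentiable ℝ (V j)) (z h : ℝ × ℝ) :
    fderiv ℝ (fun z : ℝ × ℝ => ∑ j ∈ s, U j z.1 * V j z.2) z h =
      ∑ j ∈ s, (h.1 * (deriv (U j) z.1 * V j z.2) + h.2 * (U j z.1 * deriv (V j) z.2)) := by
  have hd : ∀ j ∈ s, DifferentiableAt ℝ (fun z : ℝ × ℝ => U j z.1 * V j z.2) z := fun j _ =>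
    ((hU j).comp differentiable_fst z).mul ((hV j).comp differentiable_snd z)
  rw [fderiv_fun_sum hd, _root_.sum_apply]
  exact Finset.sum_congr rfl fun j _ => fderiv_mul_fst_snd_apply (hU j) (hV j) z h

/-- The Laplacian of `∑ U j ⊗ V j` is a Schwartz function, and its double Riesz transform is
`- (1 / 2) ∑ (U j)' ⊗ (V j)'`. -/
theorem exists_doubleRieszTransform_eq_sum {ι : Type*} (s : Finset ι) {U V : ι → ℝ → ℂ}
    (hU : ∀ j, ContDiff ℝ ((⊤ : ℕ∞) : WithTop ℕ∞) (U j)) (hUs : ∀ j, HasCompactSupport (U j))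
    (hV : ∀ j, ContDiff ℝ ((⊤ : ℕ∞) : WithTop ℕ∞) (V j)) (hVs : ∀ j, HasCompactSupport (V j)) :
    ∃ f : 𝓢(ℝ × ℝ, ℂ),
      (∀ z, f z = ∑ j ∈ s,
        (deriv (deriv (U j)) z.1 * V j z.2 + U j z.1 * deriv (deriv (V j)) z.2)) ∧
      ∀ z, doubleRieszTransform f z =
        -(1 / 2) * ∑ j ∈ s, deriv (U j) z.1 * deriv (V j) z.2 := by
  have hd : ∀ {X : ι → ℝ → ℂ}, (∀ j, ContDiff ℝ ((⊤ : ℕ∞) : WithTop ℕ∞) (X j)) →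
      ∀ j, ContDiff ℝ ((⊤ : ℕ∞) : WithTop ℕ∞) (deriv (X j)) :=
    fun hX j => (contDiff_infty_iff_deriv.1 (hX j)).2
  have hdf : ∀ {X : ι → ℝ → ℂ}, (∀ j, ContDiff ℝ ((⊤ : ℕ∞) : WithTop ℕ∞) (X j)) →
      ∀ j, Differentiable ℝ (X j) := fun hX j => (contDiff_infty_iff_deriv.1 (hX j)).1
  have h1 : (1 : WithTop ℕ∞) ≤ ((⊤ : ℕ∞) : WithTop ℕ∞) := by exact_mod_cast le_top
  have cA := contDiff_sum_mul_fst_snd s (hd (hd hU)) hV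
  have cB := contDiff_sum_mul_fst_snd s hU (hd (hd hV))
  have cW := contDiff_sum_mul_fst_snd s (hd hU) (hd hV)
  have sA := HasCompactSupport.sum_mul_fst_snd s (fun j => (hUs j).deriv.deriv) hVs
  have sB := HasCompactSupport.sum_mul_fst_snd s hUs (fun j => (hVs j).deriv.deriv)
  have sW := HasCompactSupport.sum_mul_fst_snd s (fun j => (hUs j).deriv) (fun j => (hVs j).deriv)
  refine ⟨(sA.add sB).toSchwartzMap (cA.add cB), fun z => ?_, fun z => ?_⟩
  · simp [Finset.sum_add_distrib]
  · refine doubleRieszTransform_laplacian (cA.of_le h1) (cB.of_le h1) (cW.of_le h1) sA sB sW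
      (fun z => ?_) (fun z => ?_) _ (fun z => ?_) z
    · rw [fderiv_sum_mul_fst_snd_apply s (hdf (hd (hd hU))) (hdf hV),
        fderiv_sum_mul_fst_snd_apply s (hdf (hd hU)) (hdf (hd hV))]
      simp
    · rw [fderiv_sum_mul_fst_snd_apply s (hdf hU) (hdf (hd (hd hV))),
        fderiv_sum_mul_fst_snd_apply s (hdf (hd hU)) (hdf (hd hV))]
      simp
    · simp

/-! ### Dyadic sums: a uniform upper bound and an `L^p` lower bound. -/

/-- Dilates with `2 ^ j * |s| ≥ R` vanish, and the others are dominated by a geometric series whose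
last term is below `M * R`. The bound depends on neither `s` nor `N`. In the induction the last term
is either zero or controls the whole sum. -/
theorem sum_norm_dyadic_dilates_le {b : ℝ → ℂ} {M R : ℝ} (hM : 0 ≤ M) (hR : 0 ≤ R)
    (hb : ∀ t, ‖b t‖ ≤ M * |t|) (hb0 : ∀ t, R ≤ |t| → b t = 0) (s : ℝ) (N : ℕ) :
    ∑ j ∈ Finset.range N, ‖b (2 ^ j * s)‖ ≤ 2 * M * R := by
  have habs : ∀ j : ℕ, |2 ^ j * s| = 2 ^ j * |s| := fun j => by
    rw [abs_mul, abs_of_pos (by positivity)]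
  induction N with
  | zero => simp; positivity
  | succ N ih =>
    by_cases h : R ≤ |2 ^ N * s|
    · rw [Finset.sum_range_succ, hb0 _ h, norm_zero, add_zero]
      exact ih
    · rw [habs, not_le] at h
      calc ∑ j ∈ Finset.range (N + 1), ‖b (2 ^ j * s)‖
          ≤ ∑ j ∈ Finset.range (N + 1), M * |s| * 2 ^ j :=
            Finset.sum_le_sum fun j _ => (hb _).trans (by rw [habs]; exact le_of_eq (by ring))
        _ = M * |s| * ∑ j ∈ Finset.range (N + 1), (2 : ℝ) ^ j := by rw [Finset.mul_sum]
        _ ≤ M * |s| * (2 ^ (N + 1)) := by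
            gcongr
            rw [geom_sum_eq (by norm_num)]
            norm_num
        _ = 2 * M * (2 ^ N * |s|) := by ring
        _ ≤ 2 * M * R := by gcongr

theorem norm_exp_ofReal_mul_I_mul (a x : ℝ) : ‖Complex.exp ((a : ℂ) * Complex.I * x)‖ = 1 := by
  rw [mul_right_comm, ← Complex.ofReal_mul, Complex.norm_exp_ofReal_mul_I]

/-- Expanding the square leaves only the diagonal, since exponentials with distinct integer
frequencies are orthonormal on the unit interval. -/
theorem integral_norm_sq_lacunary_sum (N : ℕ) :
    ∫ x in (0 : ℝ)..1, ‖∑ j ∈ Finset.range N,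
      Complex.exp (((2 * Real.pi * 2 ^ j : ℝ) : ℂ) * Complex.I * x)‖ ^ 2 = N := by
  have hsq : ∀ x : ℝ, ((‖∑ j ∈ Finset.range N,
      Complex.exp (((2 * Real.pi * 2 ^ j : ℝ) : ℂ) * Complex.I * x)‖ ^ 2 : ℝ) : ℂ) =
      ∑ j ∈ Finset.range N, ∑ k ∈ Finset.range N,
        Complex.exp (((2 * Real.pi * (2 ^ j - 2 ^ k) : ℝ) : ℂ) * Complex.I * x) := by
    intro x
    push_cast
    rw [← Complex.mul_conj', map_sum, Finset.sum_mul_sum]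
    refine Finset.sum_congr rfl fun j _ => Finset.sum_congr rfl fun k _ => ?_
    rw [← Complex.exp_conj, ← Complex.exp_add]
    congr 1
    simp only [map_mul, Complex.conj_ofReal, Complex.conj_I, map_pow, Complex.conj_ofNat]
    ring
  have horth : ∀ j k : ℕ, ∫ x in (0 : ℝ)..1,
      Complex.exp (((2 * Real.pi * (2 ^ j - 2 ^ k) : ℝ) : ℂ) * Complex.I * x) =
      if j = k then 1 else 0 := by
    intro j k
    split_ifs with h
    · simp [h]
    · have hne : ((2 : ℝ) ^ j - 2 ^ k) ≠ 0 := by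
        rw [sub_ne_zero]
        exact fun h' => h (pow_right_injective₀ (by norm_num) (by norm_num) h')
      rw [integral_exp_mul_complex]
      · have : Complex.exp (((2 * Real.pi * (2 ^ j - 2 ^ k) : ℝ) : ℂ) * Complex.I * (1 : ℝ)) =
            1 := by
          rw [Complex.exp_eq_one_iff]
          refine ⟨2 ^ j - 2 ^ k, ?_⟩
          push_cast
          ring
        rw [this]
        simp
      · refine mul_ne_zero ?_ Complex.I_ne_zero
        exact_mod_cast mul_ne_zero (by positivity) hne
  have hc : ((∫ x in (0 : ℝ)..1, ‖∑ j ∈ Finset.range N,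
      Complex.exp (((2 * Real.pi * 2 ^ j : ℝ) : ℂ) * Complex.I * x)‖ ^ 2 : ℝ) : ℂ) = (N : ℂ) := by
    rw [← intervalIntegral.integral_ofReal]
    simp_rw [hsq]
    rw [intervalIntegral.integral_finsetSum fun j _ =>
      Continuous.intervalIntegrable (by fun_prop) _ _]
    have hin : ∀ j, ∫ x in (0 : ℝ)..1, ∑ k ∈ Finset.range N,
        Complex.exp (((2 * Real.pi * (2 ^ j - 2 ^ k) : ℝ) : ℂ) * Complex.I * x) =
        ∑ k ∈ Finset.range N, if j = k then 1 else 0 := fun j => by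
      rw [intervalIntegral.integral_finsetSum fun k _ =>
        Continuous.intervalIntegrable (by fun_prop) _ _]
      exact Finset.sum_congr rfl fun k _ => horth j k
    rw [Finset.sum_congr rfl fun j hj =>
      (hin j).trans ((Finset.sum_ite_eq _ _ _).trans (if_pos hj))]
    simp
  exact_mod_cast hc

/-- Trigonometric sums with dyadic frequencies have `L^p` norm at least `√N`, for `p ≥ 2`. -/
theorem sqrt_le_eLpNorm_lacunary_sum {p : ℝ≥0∞} (hp : 2 ≤ p) (N : ℕ) :
    ENNReal.ofReal (√N) ≤ eLpNorm (fun x : ℝ => ∑ j ∈ Finset.range N,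
      Complex.exp (((2 * Real.pi * 2 ^ j : ℝ) : ℂ) * Complex.I * x)) p
        (volume.restrict (Set.Ioc (0 : ℝ) 1)) := by
  have hprob : IsProbabilityMeasure (volume.restrict (Set.Ioc (0 : ℝ) 1)) := ⟨by simp⟩
  have hcont : Continuous fun x : ℝ => ∑ j ∈ Finset.range N,
      Complex.exp (((2 * Real.pi * 2 ^ j : ℝ) : ℂ) * Complex.I * x) := by fun_prop
  refine le_trans (le_of_eq ?_)
    (eLpNorm_le_eLpNorm_of_exponent_le hp hcont.aestronglyMeasurable)
  have hmem : MemLp (fun x : ℝ => ∑ j ∈ Finset.range N,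
      Complex.exp (((2 * Real.pi * 2 ^ j : ℝ) : ℂ) * Complex.I * x)) 2
        (volume.restrict (Set.Ioc (0 : ℝ) 1)) := by
    refine MemLp.of_bound hcont.aestronglyMeasurable (N : ℝ) (Eventually.of_forall fun x => ?_)
    refine (norm_sum_le _ _).trans ?_
    refine (Finset.sum_le_card_nsmul _ _ 1 fun j _ => ?_).trans (by simp)
    rw [norm_exp_ofReal_mul_I_mul]
  rw [hmem.eLpNorm_eq_integral_rpow_norm two_ne_zero ENNReal.ofNat_ne_top,
    ← intervalIntegral.integral_of_le zero_le_one]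
  simp only [ENNReal.toReal_ofNat, Real.rpow_ofNat]
  rw [integral_norm_sq_lacunary_sum, Real.sqrt_eq_rpow]
  norm_num

/-! ### Bounds for the two mixed norms. -/

theorem mixedNormYX_le_of_bound {F : ℝ × ℝ → ℂ} {C R : ℝ} (p : ℝ≥0∞)
    (hF : ∀ x y, ‖F (x, y)‖ ≤ C) (hF0 : ∀ x y, R < |x| → F (x, y) = 0) :
    mixedNormYX ∞ p F ≤ eLpNorm ((Set.Icc (-R) R).indicator fun _ : ℝ => C) p volume := by
  refine eLpNorm_mono_enorm fun x => ?_
  rw [enorm_eq_self, eLpNorm_exponent_top]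
  refine eLpNormEssSup_le_of_ae_enorm_bound (Eventually.of_forall fun y => ?_)
  by_cases hx : x ∈ Set.Icc (-R) R
  · rw [Set.indicator_of_mem hx]
    rw [enorm_le_iff_norm_le]
    exact (hF x y).trans (le_abs_self C)
  · rw [hF0 x y (not_le.1 fun h => hx (abs_le.1 h))]
    simp

/-- The essential supremum does not see the single line `y = 0`, so the lower bound is needed on an
interval of positive length. Its length is irrelevant, so `δ` may later shrink with `N`. -/
theorem le_mixedNormXY_top {F : ℝ × ℝ → ℂ} {p c : ℝ≥0∞} {δ : ℝ} (hδ : 0 < δ)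
    (h : ∀ y, |y| < δ → c ≤ eLpNorm (fun x => F (x, y)) p volume) :
    c ≤ mixedNormXY p ∞ F := by
  unfold mixedNormXY
  rw [eLpNorm_exponent_top]
  by_contra hlt
  rw [not_le] at hlt
  have hae := ae_lt_of_essSup_lt hlt
  have hnull : volume (Set.Ioo (-δ) δ) = 0 := by
    refine measure_mono_null (fun y hy => ?_) hae
    simpa using h y (abs_lt.2 hy)
  simp at hnull
  linarith

/-! ### Construction of the counterexample. -/

theorem exists_smooth_cutoff : ∃ χ : ℝ → ℂ, ContDiff ℝ ((⊤ : ℕ∞) : WithTop ℕ∞) χ ∧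
    HasCompactSupport χ ∧ (∀ x, |x| < 2 → χ x = 1) ∧ ∀ x, 3 ≤ |x| → χ x = 0 := by
  let β : ContDiffBump (0 : ℝ) := ⟨2, 3, by norm_num, by norm_num⟩
  refine ⟨fun x => ((β x : ℝ) : ℂ), Complex.ofRealCLM.contDiff.comp β.contDiff,
    β.hasCompactSupport.comp_left Complex.ofReal_zero, fun x hx => ?_, fun x hx => ?_⟩
  · simp only
    rw [β.one_of_mem_closedBall, Complex.ofReal_one]
    simpa using hx.le
  · simp only
    rw [β.zero_of_le_dist, Complex.ofReal_zero]
    simpa using hx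

theorem deriv_exp_mul (c : ℂ) {X : ℝ → ℂ} (hX : Differentiable ℝ X) :
    deriv (fun x : ℝ => Complex.exp (c * x) * X x) =
      fun x : ℝ => Complex.exp (c * x) * (c * X x + deriv X x) := by
  ext x
  have h1 : HasDerivAt (fun x : ℝ => Complex.exp (c * x)) (Complex.exp (c * x) * (c * 1)) x :=
    ((Complex.ofRealCLM.hasDerivAt (x := x)).const_mul c).cexp
  refine (h1.fun_mul (hX x).hasDerivAt).deriv.trans ?_
  ring

theorem deriv_deriv_exp_mul (c : ℂ) {X : ℝ → ℂ} (hX : Differentiable ℝ X)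
    (hX' : Differentiable ℝ (deriv X)) :
    deriv (deriv fun x : ℝ => Complex.exp (c * x) * X x) =
      fun x : ℝ => Complex.exp (c * x) * (c ^ 2 * X x + 2 * c * deriv X x + deriv (deriv X) x) := by
  rw [deriv_exp_mul c hX, deriv_exp_mul c ((hX.const_mul c).fun_add hX')]
  ext x
  have : deriv (fun x => c * X x + deriv X x) x = c * deriv X x + deriv (deriv X) x :=
    (((hX x).hasDerivAt.const_mul c).add (hX' x).hasDerivAt).deriv
  simp only [this]
  ring

theorem deriv_const_mul_dilate (c : ℂ) (l : ℝ) {X : ℝ → ℂ} (hX : Differentiable ℝ X) :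
    deriv (fun y : ℝ => c * X (l * y)) = fun y => (c * l) * deriv X (l * y) := by
  ext y
  have h := ((hX (l * y)).hasDerivAt.scomp y ((hasDerivAt_id y).const_mul l)).const_mul c
  have h' : deriv (fun y : ℝ => c * X (l * y)) y = _ := h.deriv
  rw [h']
  simp
  ring

/-- Uniformly bounded Schwartz functions, supported in a fixed strip, whose double Riesz
transforms restrict near the `x`-axis to trigonometric sums with `N` dyadic frequencies. -/
theorem exists_bounded_with_lacunary_doubleRieszTransform : ∃ D : ℝ, ∀ N : ℕ,
    ∃ f : 𝓢(ℝ × ℝ, ℂ), (∀ x y, ‖f (x, y)‖ ≤ D) ∧ (∀ x y, 3 < |x| → f (x, y) = 0) ∧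
      ∃ δ > 0, ∀ y, |y| < δ → ∀ x ∈ Set.Ioc (0 : ℝ) 1, doubleRieszTransform f (x, y) =
        -(Complex.I / 2) * ∑ j ∈ Finset.range N,
          Complex.exp (((2 * Real.pi * 2 ^ j : ℝ) : ℂ) * Complex.I * x) := by
  obtain ⟨χ, hχ, hχs, hχ1, hχ0⟩ := exists_smooth_cutoff
  -- Being the identity near `0`, `η` satisfies `η(0) = η''(0) = 0`, which keeps the Laplacian
  -- bounded, and `η' = 1`, which makes the mixed derivative large.
  set η : ℝ → ℂ := fun t => (t : ℂ) * χ t with hη_def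
  have hη : ContDiff ℝ ((⊤ : ℕ∞) : WithTop ℕ∞) η := Complex.ofRealCLM.contDiff.mul hχ
  have hηs : HasCompactSupport η := hχs.mul_left
  have hη0 : ∀ t, 3 ≤ |t| → η t = 0 := fun t ht => by simp [hη_def, hχ0 t ht]
  obtain ⟨dχ, hχ'⟩ := contDiff_infty_iff_deriv.1 hχ
  obtain ⟨dχ', hχ''⟩ := contDiff_infty_iff_deriv.1 hχ'
  obtain ⟨dη, hη'⟩ := contDiff_infty_iff_deriv.1 hη
  obtain ⟨dη', hη''⟩ := contDiff_infty_iff_deriv.1 hη'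
  have hzero : ∀ {X : ℝ → ℂ}, (∀ t, 3 < |t| → X t = 0) → ∀ t, 3 < |t| → deriv X t = 0 := by
    intro X hX t ht
    have : X =ᶠ[𝓝 t] fun _ => 0 := by
      filter_upwards [(isOpen_lt continuous_const continuous_abs).mem_nhds ht] with s hs
      exact hX s hs
    rw [this.deriv_eq]
    simp
  have hχz : ∀ t, 3 < |t| → χ t = 0 := fun t ht => hχ0 t ht.le
  have hηz : ∀ t, 3 < |t| → η t = 0 := fun t ht => hη0 t ht.le
  have hχ'1 : ∀ t, |t| < 2 → deriv χ t = 0 := by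
    intro t ht
    have : χ =ᶠ[𝓝 t] fun _ => 1 := by
      filter_upwards [(isOpen_lt continuous_abs continuous_const).mem_nhds ht] with s hs
      exact hχ1 s hs
    rw [this.deriv_eq]
    simp
  have hη'1 : ∀ t, |t| < 2 → deriv η t = 1 := by
    intro t ht
    have : η =ᶠ[𝓝 t] fun s => (s : ℂ) := by
      filter_upwards [(isOpen_lt continuous_abs continuous_const).mem_nhds ht] with s hs
      simp [hη_def, hχ1 s hs]
    rw [this.deriv_eq]
    exact Complex.ofRealCLM.hasDerivAt.deriv
  have hη''0 : deriv (deriv η) 0 = 0 := by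
    have : deriv η =ᶠ[𝓝 0] fun _ => 1 := by
      filter_upwards [(isOpen_lt continuous_abs continuous_const).mem_nhds
        (show |(0 : ℝ)| < 2 by simp)] with s hs
      exact hη'1 s hs
    rw [this.deriv_eq]
    simp
  set b : ℝ → ℂ := fun t => deriv (deriv η) t - η t with hb_def
  have hbs : HasCompactSupport b := hηs.deriv.deriv.sub hηs
  have hbC : ContDiff ℝ ((⊤ : ℕ∞) : WithTop ℕ∞) b := hη''.sub hη
  obtain ⟨K, hK⟩ := hbC.lipschitzWith_of_hasCompactSupport hbs (by simp)
  have hη00 : η 0 = 0 := by simp [hη_def]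
  have hb0 : b 0 = 0 := by simp only [hb_def, hη''0, hη00, sub_zero]
  have hbK : ∀ t, ‖b t‖ ≤ K * |t| := by
    intro t
    simpa [hb0] using hK.norm_sub_le t 0
  -- The radius is `4`, not `3`, because `hzero` gives vanishing derivatives only on the open set `3
  -- < |t|`.
  have hbz : ∀ t, 4 ≤ |t| → b t = 0 := by
    intro t ht
    have ht' : 3 < |t| := by linarith
    simp [hb_def, hηz t ht', hzero (hzero hηz) t ht']
  obtain ⟨M₀, hM₀⟩ := hχs.exists_bound_of_continuous hχ.continuous
  obtain ⟨M₁, hM₁⟩ := hχs.deriv.exists_bound_of_continuous hχ'.continuous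
  obtain ⟨M₂, hM₂⟩ := hχs.deriv.deriv.exists_bound_of_continuous hχ''.continuous
  obtain ⟨M₃, hM₃⟩ := hηs.exists_bound_of_continuous hη.continuous
  have hM₀' := (norm_nonneg _).trans (hM₀ 0)
  have hM₁' := (norm_nonneg _).trans (hM₁ 0)
  have hM₂' := (norm_nonneg _).trans (hM₂ 0)
  have hM₃' := (norm_nonneg _).trans (hM₃ 0)
  -- The first summand is `sum_norm_dyadic_dilates_le` with radius `4`; the second bounds the terms
  -- where a derivative falls on `χ`, with `∑ 2⁻ʲ ≤ 2`.
  refine ⟨M₀ * (2 * K * 4) + (2 * M₁ + M₂) * M₃ * 2, fun N => ?_⟩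
  set l : ℕ → ℝ := fun j => 2 * Real.pi * 2 ^ j with hl_def
  have hl : ∀ j, (2 : ℝ) ^ j ≤ l j := by
    intro j
    have := Real.pi_gt_three
    have h2 : (0 : ℝ) < 2 ^ j := by positivity
    simp only [hl_def]
    nlinarith
  have hl1 : ∀ j, 1 ≤ l j := fun j => (one_le_pow₀ one_le_two).trans (hl j)
  have hl0 : ∀ j, 0 < l j := fun j => one_pos.trans_le (hl1 j)
  have hlc : ∀ j, (l j : ℂ) ≠ 0 := fun j => by exact_mod_cast (hl0 j).ne'
  set U : ℕ → ℝ → ℂ := fun j x => Complex.exp ((l j : ℂ) * Complex.I * x) * χ x with hU_def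
  -- Frequency in `x` and dilation in `y` are both `l j`, so every second derivative costs at most
  -- `l j ^ 2`, which the prefactor compensates.
  set V : ℕ → ℝ → ℂ := fun j y => ((l j : ℂ) ^ 2)⁻¹ * η (l j * y) with hV_def
  have hU1 : ∀ j, deriv (U j) = _ := fun j => deriv_exp_mul ((l j : ℂ) * Complex.I) dχ
  have hU2 : ∀ j, deriv (deriv (U j)) = _ :=
    fun j => deriv_deriv_exp_mul ((l j : ℂ) * Complex.I) dχ dχ'
  have hV1 : ∀ j, deriv (V j) = _ := fun j => deriv_const_mul_dilate (((l j : ℂ) ^ 2)⁻¹) (l j) dη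
  have hV2 : ∀ j, deriv (deriv (V j)) = _ := fun j => by
    rw [hV1, deriv_const_mul_dilate _ (l j) dη']
  obtain ⟨f, hf, hRf⟩ := exists_doubleRieszTransform_eq_sum (Finset.range N) (U := U) (V := V)
    (fun j => by
      refine ContDiff.mul ?_ hχ
      exact (contDiff_const.mul Complex.ofRealCLM.contDiff).cexp)
    (fun j => hχs.mul_left)
    (fun j => contDiff_const.mul (hη.comp (contDiff_const.mul contDiff_id)))
    (fun j => (hηs.comp_homeomorph (Homeomorph.mulLeft₀ (l j) (hl0 j).ne')).mul_left)
  -- For `|y| < 1 / l N` all arguments `l j * y` with `j < N` lie where `η' = 1`.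
  refine ⟨f, fun x y => ?_, fun x y hx => ?_, 1 / l N, by have := hl0 N; positivity,
    fun y hy x hx => ?_⟩
  · rw [hf]
    have hterm : ∀ j, ‖deriv (deriv (U j)) x * V j y + U j x * deriv (deriv (V j)) y‖ ≤
        M₀ * ‖b (2 ^ j * (2 * Real.pi * y))‖ + (2 * M₁ + M₂) * M₃ * (1 / 2) ^ j := by
      intro j
      have harg : 2 ^ j * (2 * Real.pi * y) = l j * y := by simp only [hl_def]; ring
      have hinv : (l j)⁻¹ ≤ (1 / 2) ^ j := by
        rw [one_div, inv_pow]
        exact inv_anti₀ (by positivity) (hl j)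
      have hinv2 : ((l j) ^ 2)⁻¹ ≤ (1 / 2) ^ j := by
        refine le_trans (inv_anti₀ (hl0 j) ?_) hinv
        nlinarith [hl1 j]
      -- The terms without a derivative on `χ` combine into `b`, the `-η` coming from `(i l_j)²
      -- l_j⁻² = -1`. Each remaining term keeps a factor `1 / l j` or smaller.
      have hexpr : deriv (deriv (U j)) x * V j y + U j x * deriv (deriv (V j)) y =
          Complex.exp ((l j : ℂ) * Complex.I * x) * (χ x * b (l j * y) +
            (2 * Complex.I * (((l j)⁻¹ : ℝ) : ℂ) * deriv χ x +
              ((((l j) ^ 2)⁻¹ : ℝ) : ℂ) * deriv (deriv χ) x) * η (l j * y)) := by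
        rw [hU2, hV2]
        simp only [hU_def, hV_def, hb_def]
        have := hlc j
        push_cast
        field_simp
        linear_combination ((l j : ℂ) ^ 2 * χ x * η (l j * y)) * Complex.I_sq
      rw [hexpr, norm_mul, norm_exp_ofReal_mul_I_mul, one_mul, harg]
      have n1 : ‖2 * Complex.I * (((l j)⁻¹ : ℝ) : ℂ) * deriv χ x‖ ≤ 2 * (1 / 2) ^ j * M₁ := by
        rw [norm_mul, norm_mul, norm_mul, Complex.norm_I, Complex.norm_real, Real.norm_eq_abs,
          abs_of_pos (inv_pos.2 (hl0 j)), Complex.norm_ofNat, mul_one]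
        gcongr
        exact hM₁ x
      have n2 : ‖((((l j) ^ 2)⁻¹ : ℝ) : ℂ) * deriv (deriv χ) x‖ ≤ (1 / 2) ^ j * M₂ := by
        rw [norm_mul, Complex.norm_real, Real.norm_eq_abs,
          abs_of_pos (inv_pos.2 (pow_pos (hl0 j) 2))]
        gcongr
        exact hM₂ x
      refine (norm_add_le _ _).trans (add_le_add ?_ ?_)
      · rw [norm_mul]
        gcongr
        exact hM₀ x
      · rw [norm_mul]
        calc _ ≤ (2 * (1 / 2) ^ j * M₁ + (1 / 2) ^ j * M₂) * M₃ := by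
              gcongr
              · exact (norm_add_le _ _).trans (add_le_add n1 n2)
              · exact hM₃ _
          _ = _ := by ring
    refine (norm_sum_le _ _).trans ((Finset.sum_le_sum fun j _ => hterm j).trans ?_)
    rw [Finset.sum_add_distrib, ← Finset.mul_sum, ← Finset.mul_sum]
    gcongr
    · exact sum_norm_dyadic_dilates_le K.2 (by norm_num) hbK hbz _ N
    · have h := summable_geometric_two.sum_le_tsum (Finset.range N) (fun _ _ => by positivity)
      rwa [tsum_geometric_two] at h
  · rw [hf]
    refine Finset.sum_eq_zero fun j _ => ?_
    rw [hU2]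
    simp [hU_def, hχz x hx, hzero hχz x hx, hzero (hzero hχz) x hx]
  · rw [hRf, Finset.mul_sum, Finset.mul_sum]
    refine Finset.sum_congr rfl fun j hj => ?_
    have hx2 : |x| < 2 := by rw [abs_of_pos hx.1]; linarith [hx.2]
    have hy2 : |l j * y| < 2 := by
      have hlj : l j ≤ l N := by
        simp only [hl_def]
        have := (Finset.mem_range.1 hj).le
        have := Real.pi_pos
        gcongr
        norm_num
      have h1 : l N * |y| < 1 := by
        rwa [lt_div_iff₀ (hl0 N), mul_comm] at hy
      rw [abs_mul, abs_of_pos (hl0 j)]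
      have := mul_le_mul_of_nonneg_right hlj (abs_nonneg y)
      linarith
    rw [hU1, hV1]
    simp only [hχ1 x hx2, hχ'1 x hx2, hη'1 _ hy2]
    have := hlc j
    change _ = -(Complex.I / 2) * Complex.exp ((l j : ℂ) * Complex.I * x)
    field_simp
    ring

theorem theorem2p5 (p : ℝ) (hp : 2 < p) :
    ¬ ∃ C : ℝ≥0, ∀ f : 𝓢(ℝ × ℝ, ℂ),
      mixedNormXY (ENNReal.ofReal p) ∞ (doubleRieszTransform f) ≤
        C * mixedNormYX ∞ (ENNReal.ofReal p) f := by
  rintro ⟨C, hC⟩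
  obtain ⟨D, hD⟩ := exists_bounded_with_lacunary_doubleRieszTransform
  have hp2 : (2 : ℝ≥0∞) ≤ ENNReal.ofReal p := by
    rw [← ENNReal.ofReal_ofNat]
    exact ENNReal.ofReal_le_ofReal hp.le
  set E := eLpNorm ((Set.Icc (-3 : ℝ) 3).indicator fun _ : ℝ => D) (ENNReal.ofReal p) volume
    with hE
  have hEtop : E ≠ ∞ :=
    (memLp_indicator_const (ENNReal.ofReal p) measurableSet_Icc D (Or.inr (by simp))).2.ne
  have hbound : ∀ N : ℕ, ENNReal.ofReal (1 / 2) * ENNReal.ofReal (√N) ≤ C * E := by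
    intro N
    obtain ⟨f, hfD, hf0, δ, hδ, hR⟩ := hD N
    refine le_trans ?_ ((hC f).trans (by gcongr; exact mixedNormYX_le_of_bound _ hfD hf0))
    refine le_mixedNormXY_top hδ fun y hy => ?_
    refine le_trans ?_ (eLpNorm_mono_measure _
      (Measure.restrict_le_self (μ := volume) (s := Set.Ioc (0 : ℝ) 1)))
    rw [eLpNorm_congr_ae ((ae_restrict_iff' measurableSet_Ioc).2
      (Eventually.of_forall fun x hx => hR y hy x hx))]
    have hconst := eLpNorm_const_smul (-(Complex.I / 2)) (fun x : ℝ => ∑ j ∈ Finset.range N,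
      Complex.exp (((2 * Real.pi * 2 ^ j : ℝ) : ℂ) * Complex.I * x)) (ENNReal.ofReal p)
      (volume.restrict (Set.Ioc (0 : ℝ) 1))
    have henorm : ‖-(Complex.I / 2)‖ₑ = ENNReal.ofReal (1 / 2) := by
      rw [← ofReal_norm]
      simp
    rw [henorm] at hconst
    refine le_trans ?_ hconst.ge
    gcongr
    exact sqrt_le_eLpNorm_lacunary_sum hp2 N
  have hCE : (C : ℝ≥0∞) * E ≠ ∞ := ENNReal.mul_ne_top ENNReal.coe_ne_top hEtop
  -- Taking `N = n ^ 2` makes `√N = n`, so `hbound` would give `n / 2 ≤ C * E`.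
  obtain ⟨n, hn⟩ := exists_nat_gt (2 * ((C : ℝ≥0∞) * E).toReal)
  have h := hbound (n ^ 2)
  rw [← ENNReal.ofReal_mul (by norm_num), ENNReal.ofReal_le_iff_le_toReal hCE] at h
  push_cast at h
  rw [Real.sqrt_sq (Nat.cast_nonneg n)] at h
  linarith
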